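/- Let $F:\mathbb R\to\mathbb R$ be non-decreasing and let $\mu=dF$ be the Borel measure on $\mathbb R$ determined by $\mu((a,b])=F(b)-F(a)$ for all continuity points $a<b$ of $F$. Suppose that $\int_{\mathbb R} e^{-\varepsilon u^2}\,\mu(du)<\infty$ for every $\varepsilon>0$. Let $T>0$, $H\in(1/2,1)$ and $p\in[1,H/(1-H))$. Let $B_H=(B_H(t))_{t\ge 0}$ be a fractional Brownian motion with Hurst index $H$, that is, a centered Gaussian process with $\mathrm{Cov}(B_H(s),B_H(t))=\tfrac12\left(t^{2H}+s^{2H}-|t-s|^{2H}\right)$. Write $\|\xi\|_p=(\mathbb E|\xi|^p)^{1/p}$. Then the Riemann–Stieltjes integral $I=\int_0^T F(B_H)\,dB_H$ exists as a limit in $L_p$: there is a random variable $I\in L_p$ such that $$\Big\|I-\sum_{i=1}^n F(B_H(s_i))\,\big(B_H(t_i)-B_H(t_{i-1})\big)\Big\|_p\to 0$$ as the mesh $\max_{1\le i\le n}(t_i-t_{i-1})$ of the partition $0=t_0<t_1<\dots<t_n=T$ tends to $0$, uniformly over such partitions and over tags $s_i\in[t_{i-1},t_i]$ (in particular for the forward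 sums, $s_i=t_{i-1}$). Moreover, $$\int_0^{B_H(T)}F(x)\,dx=I\quad\text{almost surely},$$ and for every $q\in(p,H/(1-H))$ there is a constant $C=C(p,q,T,H,F)$, depending on nothing else, such that for every partition $0=t_0<t_1<\dots<t_n=T$ with mesh $d$, $$\Big\|I-\sum_{i=1}^n F(B_H(t_{i-1}))\,\big(B_H(t_i)-B_H(t_{i-1})\big)\Big\|_p\le C\,T^{1-H/q}\,d^{H/q+H-1}.$$ -/

import Mathlib

open MeasureTheory ProbabilityTheory
open scoped NNReal ENNReal

noncomputable section

/-- A fractional Brownian motion with Hurst index `H`: a centered Gaussian process on `[0, ∞)`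
with covariance `(t ^ (2H) + s ^ (2H) - |t - s| ^ (2H)) / 2`. Path continuity is not required, so
every version of the process is covered. -/
structure IsFractionalBrownianMotion {Ω : Type*} [MeasurableSpace Ω] (H : ℝ)
    (B : ℝ≥0 → Ω → ℝ) (P : Measure Ω) : Prop where
  isGaussianProcess : IsGaussianProcess B P
  mean_zero : ∀ t, ∫ ω, B t ω ∂P = 0
  covariance_eq : ∀ s t : ℝ≥0, covariance (B s) (B t) P =
    ((t : ℝ) ^ (2 * H) + (s : ℝ) ^ (2 * H) - |(t : ℝ) - (s : ℝ)| ^ (2 * H)) / 2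

/-- `0 = t 0 < t 1 < ⋯ < t n = T` is a partition of `[0, T]`. -/
structure IsTimePartition (T : ℝ≥0) {n : ℕ} (t : Fin (n + 1) → ℝ≥0) : Prop where
  first : t 0 = 0
  last : t (Fin.last n) = T
  strictMono : StrictMono t

/-- The mesh `max {t_i - t_{i-1} : 1 ≤ i ≤ n}` of a partition. -/
def timeMesh {n : ℕ} (t : Fin (n + 1) → ℝ≥0) : ℝ≥0 :=
  Finset.univ.sup fun i : Fin n => t i.succ - t i.castSucc

/-- The Riemann-Stieltjes sum `∑ Y(s_i) (X(t_i) - X(t_{i-1}))` with tags `s`. -/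
def stieltjesSum {Ω : Type*} (Y X : ℝ≥0 → Ω → ℝ) {n : ℕ} (t : Fin (n + 1) → ℝ≥0)
    (s : Fin n → ℝ≥0) (ω : Ω) : ℝ :=
  ∑ i : Fin n, Y (s i) ω * (X (t i.succ) ω - X (t i.castSucc) ω)

/-- The forward integral sum `∑ Y(t_{i-1}) (X(t_i) - X(t_{i-1}))`. -/
def forwardSum {Ω : Type*} (Y X : ℝ≥0 → Ω → ℝ) {n : ℕ} (t : Fin (n + 1) → ℝ≥0) : Ω → ℝ :=
  stieltjesSum Y X t fun i => t i.castSucc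

/-- The random variable `I` is the Riemann-Stieltjes integral `∫_0^T Y dX` in `L_p`: it is the
`L_p` limit, as the mesh tends to zero, of the integral sums over partitions of `[0, T]` with
arbitrary tags `s_i ∈ [t_{i-1}, t_i]`. -/
structure IsStieltjesIntegral {Ω : Type*} [MeasurableSpace Ω] (P : Measure Ω) (p : ℝ≥0∞)
    (Y X : ℝ≥0 → Ω → ℝ) (T : ℝ≥0) (I : Ω → ℝ) : Prop where
  memLp : MemLp I p P
  tendsto : ∀ ε : ℝ≥0∞, 0 < ε → ∃ δ : ℝ≥0, 0 < δ ∧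
    ∀ (n : ℕ) (t : Fin (n + 1) → ℝ≥0) (s : Fin n → ℝ≥0), IsTimePartition T t →
      (∀ i, s i ∈ Set.Icc (t i.castSucc) (t i.succ)) → timeMesh t < δ →
        eLpNorm (fun ω => I ω - stieltjesSum Y X t s ω) p P ≤ ε

end

/-!
The integral is `I = G (B T)`, where `G` is the primitive of `F` vanishing at zero. Since `B 0 = 0`
almost surely, the difference between `I` and a Riemann-Stieltjes sum is the sum, over the intervals
`[a, b]` of the partition, of `∫ (F x - F (B s)) dx` for `x` running from `B a` to `B b`. By
monotonicity each term is at most `|B b - B a|` times the sum of two increments of `F` along the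
path, both of the form `|F (B b) - F (B r)|` with `r ∈ [a, b]` (`Monotone.enorm_integral_sub_le`).

Such an increment is controlled by the mass that `dF` gives to the segment between `B r` and `B b`.
With the finite measure `ν = exp (-ε u ^ 2) dF(u)` and any `0 < γ < 1`,
`|F y - F x| ^ p ≤ ν(ℝ) ^ (p - 1) exp (ε p (x ^ 2 + y ^ 2)) |y - x| ^ γ ∫ |y - u| ^ (-γ) dν(u)`
(`Monotone.enorm_sub_rpow_le`): the exponential undoes the tilt, and `(|y - x| / |y - u|) ^ γ ≥ 1`
when `u` lies between `x` and `y`. For Gaussian variables, Tonelli's theorem and Hölder's inequality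
reduce the expectation to Gaussian moments, small exponential moments of squares, and negative
moments `E |B b - u| ^ (-η)` with `η < 1`. The latter are at most a constant times `b ^ (-H η)`
uniformly in `u`, because the density of `B b` is bounded by `b ^ (-H)`
(`lintegral_increment_le`). No joint density is needed.

With `γ = p / q` each interval contributes at most a constant times
`(b - a) ^ (H + H / q) b ^ (-H / q)` to the `L_p` norm of the error. Since `q < H / (1 - H)`, the
exponent `H / q + H - 1` is positive, and a power of the mesh with this exponent factors out of the
sum. What remains is a Riemann sum of `∫ x ^ (-H / q) dx` over `[0, T]`, which is bounded by
`T ^ (1 - H / q) / (1 - H / q)` through telescoping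
(`IsTimePartition.sum_rpow_mul_rpow_neg_le`). The estimate is the same for all tags, so the rate
for one `q` between `p` and `H / (1 - H)` gives the existence of the integral as well.
-/

/-! ### Gaussian moments -/

/-- The absolute moment of order `m` of the standard Gaussian law. -/
noncomputable def gaussianAbsMoment (m : ℝ) : ℝ≥0∞ := ∫⁻ x, ‖x‖ₑ ^ m ∂gaussianReal 0 1

lemma gaussianAbsMoment_lt_top {m : ℝ} (hm : 0 < m) : gaussianAbsMoment m < ∞ := by
  have h := memLp_id_gaussianReal' (μ := 0) (v := 1) (ENNReal.ofReal m) ENNReal.ofReal_ne_top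
  have h2 := lintegral_rpow_enorm_lt_top_of_eLpNorm_lt_top (by simpa using hm)
    ENNReal.ofReal_ne_top h.2
  simpa [ENNReal.toReal_ofReal hm.le, gaussianAbsMoment] using h2

/-- An upper bound, for `0 ≤ η < 1`, of the negative moments `E |N - v| ^ (-η)` of the standard
Gaussian law, uniform in the centre `v`. The density being at most one, the part of the integral
close to `v` is bounded by that of Lebesgue measure. -/
noncomputable def negMomentBound (η : ℝ) : ℝ≥0∞ := 1 + ∫⁻ x in Set.Icc (-1 : ℝ) 1, ‖x‖ₑ ^ (-η)

lemma negMomentBound_lt_top {η : ℝ} (hη1 : η < 1) : negMomentBound η < ∞ := by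
  have h := (intervalIntegral.intervalIntegrable_rpow' (a := 0) (b := 1) (r := -η) (by linarith))
  have h1 : ∫⁻ x in Set.Ioc (0 : ℝ) 1, ‖x‖ₑ ^ (-η) < ∞ := by
    rw [intervalIntegrable_iff_integrableOn_Ioc_of_le zero_le_one] at h
    refine lt_of_le_of_lt (setLIntegral_mono' measurableSet_Ioc fun x hx => ?_) h.2
    rw [Real.enorm_eq_ofReal_abs, abs_of_pos hx.1, Real.enorm_eq_ofReal_abs,
      abs_of_nonneg (Real.rpow_nonneg hx.1.le _), ENNReal.ofReal_rpow_of_pos hx.1]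
  have h2 : ∫⁻ x in Set.Ico (-1 : ℝ) 0, ‖x‖ₑ ^ (-η) < ∞ := by
    have := (Measure.measurePreserving_neg (volume : Measure ℝ)).setLIntegral_comp_preimage
      (s := Set.Ioc (0 : ℝ) 1) measurableSet_Ioc (f := fun x : ℝ => ‖x‖ₑ ^ (-η)) (by fun_prop)
    simp only [enorm_neg] at this
    rw [← this] at h1
    simpa using h1
  have h3 : (Set.Icc (-1 : ℝ) 1) = (Set.Ico (-1 : ℝ) 0 ∪ {0}) ∪ Set.Ioc (0 : ℝ) 1 := by
    ext x
    simp only [Set.mem_Icc, Set.mem_union, Set.mem_Ico, Set.mem_Ioc, Set.mem_singleton_iff]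
    constructor
    · rintro ⟨h, h'⟩
      rcases lt_trichotomy x 0 with h0 | h0 | h0 <;> simp [*]
    · rintro ((h | h) | h)
      · exact ⟨h.1, by linarith⟩
      · subst h; norm_num
      · exact ⟨by linarith, h.2⟩
  rw [negMomentBound, h3]
  refine ENNReal.add_lt_top.2 ⟨by simp, ?_⟩
  refine (lintegral_union_le _ _ _).trans_lt (ENNReal.add_lt_top.2 ⟨?_, h1⟩)
  refine (lintegral_union_le _ _ _).trans_lt (ENNReal.add_lt_top.2 ⟨h2, by simp⟩)

/-- A bound of `E exp (c X ^ 2)` for centred Gaussian `X` with `c Var X ≤ 1 / 4`. -/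
noncomputable def expSqBound : ℝ≥0∞ := ∫⁻ x, ENNReal.ofReal (Real.exp (x ^ 2 / 4)) ∂gaussianReal 0 1

lemma lintegral_gaussianReal_le (f : ℝ → ℝ≥0∞) (hf : Measurable f) :
    ∫⁻ x, f x ∂gaussianReal 0 1 ≤ ∫⁻ x, ENNReal.ofReal (Real.exp (-x ^ 2 / 2)) * f x := by
  rw [gaussianReal_of_var_ne_zero _ one_ne_zero,
    lintegral_withDensity_eq_lintegral_mul _ (measurable_gaussianPDF 0 1) hf]
  refine lintegral_mono fun x => ?_
  simp only [Pi.mul_apply]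
  gcongr
  refine ENNReal.ofReal_le_ofReal ?_
  simp only [gaussianPDFReal, NNReal.coe_one, mul_one, sub_zero]
  refine mul_le_of_le_one_left (Real.exp_pos _).le (inv_le_one_of_one_le₀ ?_)
  rw [Real.one_le_sqrt]
  nlinarith [Real.pi_gt_three]

lemma expSqBound_lt_top : expSqBound < ∞ := by
  refine (lintegral_gaussianReal_le _ (by fun_prop)).trans_lt ?_
  have h := (integrable_exp_neg_mul_sq (b := 1 / 4) (by norm_num)).2
  refine lt_of_le_of_lt (lintegral_mono fun x => ?_) h
  rw [Real.enorm_eq_ofReal_abs, abs_of_pos (Real.exp_pos _), ← ENNReal.ofReal_mul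
    (Real.exp_pos _).le, ← Real.exp_add]
  refine ENNReal.ofReal_le_ofReal (Real.exp_le_exp.2 (by linarith))

lemma lintegral_standard_sub_rpow_neg_le {η : ℝ} (hη : 0 ≤ η) (v : ℝ) :
    ∫⁻ x, ‖x - v‖ₑ ^ (-η) ∂gaussianReal 0 1 ≤ negMomentBound η := by
  have h : ∀ x : ℝ, ‖x - v‖ₑ ^ (-η) ≤
      1 + (Set.Icc (-1 : ℝ) 1).indicator (fun y => ‖y‖ₑ ^ (-η)) (x - v) := by
    intro x
    by_cases hx : x - v ∈ Set.Icc (-1 : ℝ) 1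
    · simp [hx]
    · have h1 : (1 : ℝ≥0∞) ≤ ‖x - v‖ₑ := by
        rw [Real.enorm_eq_ofReal_abs, ENNReal.one_le_ofReal]
        by_contra! hlt
        exact hx (abs_le.1 hlt.le)
      have h2 : ‖x - v‖ₑ ^ (-η) ≤ 1 := by
        rw [ENNReal.rpow_neg, ENNReal.inv_le_one, ← ENNReal.one_rpow η]
        exact ENNReal.rpow_le_rpow h1 hη
      simpa [hx] using h2
  have hm : Measurable ((Set.Icc (-1 : ℝ) 1).indicator (fun y : ℝ => ‖y‖ₑ ^ (-η))) :=
    Measurable.indicator (by fun_prop) measurableSet_Icc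
  calc _ ≤ ∫⁻ x, 1 + (Set.Icc (-1 : ℝ) 1).indicator (fun y => ‖y‖ₑ ^ (-η)) (x - v)
          ∂gaussianReal 0 1 := lintegral_mono h
    _ = 1 + ∫⁻ x, (Set.Icc (-1 : ℝ) 1).indicator (fun y => ‖y‖ₑ ^ (-η)) (x - v)
          ∂gaussianReal 0 1 := by
        rw [lintegral_add_left measurable_const]; simp
    _ ≤ 1 + ∫⁻ x, (Set.Icc (-1 : ℝ) 1).indicator (fun y => ‖y‖ₑ ^ (-η)) (x - v) := by
        refine add_le_add le_rfl ((lintegral_gaussianReal_le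
          (fun x => (Set.Icc (-1 : ℝ) 1).indicator (fun y => ‖y‖ₑ ^ (-η)) (x - v))
          (hm.comp (measurable_id.sub_const v))).trans
          (lintegral_mono fun x => mul_le_of_le_one_left' ?_))
        rw [ENNReal.ofReal_le_one, Real.exp_le_one_iff]
        nlinarith [sq_nonneg x]
    _ = negMomentBound η := by
        rw [lintegral_sub_right_eq_self (μ := volume)
          (fun x => (Set.Icc (-1 : ℝ) 1).indicator (fun y : ℝ => ‖y‖ₑ ^ (-η)) x) v,
          lintegral_indicator measurableSet_Icc, negMomentBound]

section

variable {Ω : Type*} [MeasurableSpace Ω] {P : Measure Ω} {X : Ω → ℝ} {σ : ℝ≥0}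

/-- Scaling: integrals against a centred Gaussian variable of standard deviation `σ` are integrals
against the standard Gaussian law. -/
lemma ProbabilityTheory.HasLaw.lintegral_comp_gaussianReal
    (hX : HasLaw X (gaussianReal 0 (σ ^ 2)) P) {f : ℝ → ℝ≥0∞} (hf : Measurable f) :
    ∫⁻ ω, f (X ω) ∂P = ∫⁻ x, f (σ * x) ∂gaussianReal 0 1 := by
  have h : gaussianReal 0 (σ ^ 2) = (gaussianReal 0 1).map (fun x => (σ : ℝ) * x) := by
    rw [gaussianReal_map_const_mul]
    congr 1
    · simp
    · ext; simp
  rw [hX.lintegral_comp hf.aemeasurable, h, lintegral_map hf (by fun_prop)]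

lemma ProbabilityTheory.HasLaw.lintegral_enorm_rpow
    (hX : HasLaw X (gaussianReal 0 (σ ^ 2)) P) {m : ℝ} (hm : 0 ≤ m) :
    ∫⁻ ω, ‖X ω‖ₑ ^ m ∂P = (σ : ℝ≥0∞) ^ m * gaussianAbsMoment m := by
  rw [hX.lintegral_comp_gaussianReal (f := fun x => ‖x‖ₑ ^ m) (by fun_prop), gaussianAbsMoment,
    ← lintegral_const_mul _ (by fun_prop)]
  refine lintegral_congr fun x => ?_
  rw [enorm_mul, ENNReal.mul_rpow_of_nonneg _ _ hm]
  simp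

lemma ProbabilityTheory.HasLaw.lintegral_sub_rpow_neg_le
    (hX : HasLaw X (gaussianReal 0 (σ ^ 2)) P) (hσ : 0 < σ) {η : ℝ} (hη : 0 ≤ η) (u : ℝ) :
    ∫⁻ ω, ‖X ω - u‖ₑ ^ (-η) ∂P ≤ (σ : ℝ≥0∞) ^ (-η) * negMomentBound η := by
  rw [hX.lintegral_comp_gaussianReal (f := fun x => ‖x - u‖ₑ ^ (-η)) (by fun_prop)]
  calc _ = ∫⁻ x, (σ : ℝ≥0∞) ^ (-η) * ‖x - u / σ‖ₑ ^ (-η) ∂gaussianReal 0 1 := by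
        refine lintegral_congr fun x => ?_
        have : (σ : ℝ) * x - u = σ * (x - u / σ) := by field_simp
        rw [this, enorm_mul, ENNReal.mul_rpow_of_ne_top (by simp) (by simp)]
        simp
    _ = (σ : ℝ≥0∞) ^ (-η) * ∫⁻ x, ‖x - u / σ‖ₑ ^ (-η) ∂gaussianReal 0 1 :=
        lintegral_const_mul _ (by fun_prop)
    _ ≤ _ := by gcongr; exact lintegral_standard_sub_rpow_neg_le hη _

lemma ProbabilityTheory.HasLaw.lintegral_exp_mul_sq_le
    (hX : HasLaw X (gaussianReal 0 (σ ^ 2)) P) {c : ℝ} (hc : c * σ ^ 2 ≤ 1 / 4) :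
    ∫⁻ ω, ENNReal.ofReal (Real.exp (c * X ω ^ 2)) ∂P ≤ expSqBound := by
  rw [hX.lintegral_comp_gaussianReal (f := fun x => ENNReal.ofReal (Real.exp (c * x ^ 2)))
    (by fun_prop)]
  refine lintegral_mono fun x => ENNReal.ofReal_le_ofReal (Real.exp_le_exp.2 ?_)
  nlinarith [sq_nonneg x, mul_le_mul_of_nonneg_right hc (sq_nonneg x)]

end

/-! ### Increments of a monotone function -/

lemma Monotone.enorm_sub_le_measure_uIcc {F : ℝ → ℝ} (hF : Monotone F) (x y : ℝ) :
    ‖F y - F x‖ₑ ≤ hF.stieltjesFunction.measure (Set.uIcc x y) := by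
  wlog hxy : x ≤ y generalizing x y
  · rw [enorm_sub_rev, Set.uIcc_comm]
    exact this y x (le_of_not_ge hxy)
  rw [Set.uIcc_of_le hxy, StieltjesFunction.measure_Icc, Real.enorm_eq_ofReal_abs,
    abs_of_nonneg (sub_nonneg.2 (hF hxy))]
  refine ENNReal.ofReal_le_ofReal (sub_le_sub (hF.le_rightLim le_rfl) ?_)
  refine _root_.le_of_tendsto (hF.stieltjesFunction.mono.tendsto_leftLim x) ?_
  filter_upwards [self_mem_nhdsWithin] with z hz
  exact hF.rightLim_le hz

/-- The finite measure `exp (-ε u ^ 2) dF(u)`. -/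
noncomputable def Monotone.gaussianTilt {F : ℝ → ℝ} (hF : Monotone F) (ε : ℝ) : Measure ℝ :=
  hF.stieltjesFunction.measure.withDensity fun u => ENNReal.ofReal (Real.exp (-ε * u ^ 2))

/-- On the segment between `x` and `y` the density `exp (-ε u ^ 2)` is at least
`exp (-ε (x ^ 2 + y ^ 2))`. -/
lemma Monotone.measure_uIcc_le {F : ℝ → ℝ} (hF : Monotone F) {ε : ℝ} (hε : 0 ≤ ε) (x y : ℝ) :
    hF.stieltjesFunction.measure (Set.uIcc x y) ≤
      ENNReal.ofReal (Real.exp (ε * (x ^ 2 + y ^ 2))) * hF.gaussianTilt ε (Set.uIcc x y) := by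
  rw [gaussianTilt, withDensity_apply _ measurableSet_uIcc,
    ← lintegral_const_mul _ (by fun_prop), ← setLIntegral_one]
  refine setLIntegral_mono' measurableSet_uIcc fun u hu => ?_
  rw [← ENNReal.ofReal_mul (Real.exp_pos _).le, ← Real.exp_add, ENNReal.one_le_ofReal,
    Real.one_le_exp_iff]
  have : u ^ 2 ≤ x ^ 2 + y ^ 2 := by
    rcases Set.mem_uIcc.1 hu with ⟨h1, h2⟩ | ⟨h1, h2⟩ <;>
    · rcases le_total 0 u with h | h <;> nlinarith [sq_nonneg x, sq_nonneg y]
  nlinarith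

/-- For `u` between `x` and `y ≠ x` the ratio `|y - x| / |y - u|` is at least one. Its power of
order `γ` dominates the indicator of the segment, and is integrable in `y` near `u` for `γ < 1`. -/
lemma measure_uIcc_le_lintegral_rpow_neg (ν : Measure ℝ) {γ : ℝ} (hγ : 0 ≤ γ) {x y : ℝ}
    (hxy : x ≠ y) :
    ν (Set.uIcc x y) ≤ ‖y - x‖ₑ ^ γ * ∫⁻ u, ‖y - u‖ₑ ^ (-γ) ∂ν := by
  rw [← lintegral_const_mul _ (by fun_prop), ← setLIntegral_one]
  refine (setLIntegral_mono' (g := fun u => ‖y - x‖ₑ ^ γ * ‖y - u‖ₑ ^ (-γ)) measurableSet_uIcc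
    fun u hu => ?_).trans (setLIntegral_le_lintegral _ _)
  have h0 : ‖y - x‖ₑ ^ γ ≠ 0 := by simp [sub_eq_zero, hxy.symm, ENNReal.rpow_eq_zero_iff]
  have h1 : ‖y - x‖ₑ ^ γ ≠ ∞ := ENNReal.rpow_ne_top_of_nonneg hγ enorm_ne_top
  have h2 : ‖y - u‖ₑ ≤ ‖y - x‖ₑ := by
    rw [Real.enorm_eq_ofReal_abs, Real.enorm_eq_ofReal_abs]
    exact ENNReal.ofReal_le_ofReal (Set.abs_sub_right_of_mem_uIcc hu)
  rw [← ENNReal.mul_inv_cancel h0 h1, ← ENNReal.rpow_neg]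
  refine mul_le_mul_right ?_ _
  rw [ENNReal.rpow_neg, ENNReal.rpow_neg]
  exact ENNReal.inv_le_inv.2 (ENNReal.rpow_le_rpow h2 hγ)

/-- Pointwise bound of the increment of `F` by a singular integral. -/
lemma Monotone.enorm_sub_rpow_le {F : ℝ → ℝ} (hF : Monotone F) {ε : ℝ} (hε : 0 ≤ ε) {p γ : ℝ}
    (hp : 1 ≤ p) (hγ : 0 ≤ γ) (x y : ℝ) :
    ‖F y - F x‖ₑ ^ p ≤ hF.gaussianTilt ε Set.univ ^ (p - 1) *
      (ENNReal.ofReal (Real.exp (ε * p * x ^ 2)) * ENNReal.ofReal (Real.exp (ε * p * y ^ 2)) *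
        (‖y - x‖ₑ ^ γ * ∫⁻ u, ‖y - u‖ₑ ^ (-γ) ∂hF.gaussianTilt ε)) := by
  -- For `x = y` the segment may carry an atom while `|y - x| ^ γ` vanishes, but `F y - F x = 0`.
  rcases eq_or_ne x y with rfl | hxy
  · simp [ENNReal.zero_rpow_of_pos (show 0 < p by linarith)]
  have hp0 : 0 ≤ p := by linarith
  set ν := hF.gaussianTilt ε
  have h2 : ENNReal.ofReal (Real.exp (ε * (x ^ 2 + y ^ 2))) ^ p =
      ENNReal.ofReal (Real.exp (ε * p * x ^ 2)) * ENNReal.ofReal (Real.exp (ε * p * y ^ 2)) := by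
    rw [← ENNReal.ofReal_mul (Real.exp_pos _).le, ← Real.exp_add,
      ENNReal.ofReal_rpow_of_pos (Real.exp_pos _), ← Real.exp_mul]
    ring_nf
  have h3 : ν (Set.uIcc x y) ^ p ≤ ν Set.univ ^ (p - 1) * ν (Set.uIcc x y) := by
    calc ν (Set.uIcc x y) ^ p = ν (Set.uIcc x y) ^ (p - 1) * ν (Set.uIcc x y) ^ (1 : ℝ) := by
          rw [← ENNReal.rpow_add_of_nonneg _ _ (by linarith) zero_le_one]; ring_nf
      _ ≤ _ := by
          rw [ENNReal.rpow_one]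
          refine mul_le_mul_left (ENNReal.rpow_le_rpow (measure_mono (Set.subset_univ _)) ?_) _
          linarith
  calc ‖F y - F x‖ₑ ^ p
      ≤ (ENNReal.ofReal (Real.exp (ε * (x ^ 2 + y ^ 2))) * ν (Set.uIcc x y)) ^ p :=
        ENNReal.rpow_le_rpow ((hF.enorm_sub_le_measure_uIcc x y).trans
          (hF.measure_uIcc_le hε x y)) hp0
    _ = (ENNReal.ofReal (Real.exp (ε * p * x ^ 2)) * ENNReal.ofReal (Real.exp (ε * p * y ^ 2))) *
          ν (Set.uIcc x y) ^ p := by rw [ENNReal.mul_rpow_of_nonneg _ _ hp0, h2]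
    _ ≤ (ENNReal.ofReal (Real.exp (ε * p * x ^ 2)) * ENNReal.ofReal (Real.exp (ε * p * y ^ 2))) *
          (ν Set.univ ^ (p - 1) * (‖y - x‖ₑ ^ γ * ∫⁻ u, ‖y - u‖ₑ ^ (-γ) ∂ν)) := by
        gcongr
        exact h3.trans (mul_le_mul_right (measure_uIcc_le_lintegral_rpow_neg ν hγ hxy) _)
    _ = _ := by ring

/-- The primitive of a monotone function differs from its Riemann-Stieltjes summand, with tag value
`z`, by at most the increment times oscillations of `F` measured from `F y`. -/
lemma Monotone.enorm_integral_sub_le {F : ℝ → ℝ} (hF : Monotone F) (x y z : ℝ) :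
    ‖(∫ u in x..y, F u) - F z * (y - x)‖ₑ ≤
      ‖(y - x) * (F y - F x)‖ₑ + ‖(y - x) * (F y - F z)‖ₑ := by
  have h1 : (∫ u in x..y, F u) - F z * (y - x) = ∫ u in x..y, (F u - F z) := by
    rw [intervalIntegral.integral_sub hF.intervalIntegrable (by simp)]
    simp [mul_comm]
  have h2 : ‖∫ u in x..y, (F u - F z)‖ ≤ (|F y - F x| + |F y - F z|) * |y - x| := by
    refine intervalIntegral.norm_integral_le_of_norm_le_const fun u hu => ?_
    have hu' := Set.uIoc_subset_uIcc hu
    have h3 : |F y - F u| ≤ |F y - F x| := by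
      rcases Set.mem_uIcc.1 hu' with ⟨h1, h2⟩ | ⟨h1, h2⟩
      · rw [abs_of_nonneg (sub_nonneg.2 (hF h2)), abs_of_nonneg (sub_nonneg.2 (hF (h1.trans h2)))]
        linarith [hF h1]
      · rw [abs_of_nonpos (sub_nonpos.2 (hF h1)), abs_of_nonpos (sub_nonpos.2 (hF (h1.trans h2)))]
        linarith [hF h2]
    calc ‖F u - F z‖ = |(F y - F z) - (F y - F u)| := by rw [Real.norm_eq_abs]; ring_nf
      _ ≤ |F y - F z| + |F y - F u| := abs_sub _ _
      _ ≤ _ := by linarith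
  rw [h1, Real.enorm_eq_ofReal_abs, Real.enorm_eq_ofReal_abs, Real.enorm_eq_ofReal_abs,
    ← ENNReal.ofReal_add (abs_nonneg _) (abs_nonneg _), abs_mul, abs_mul]
  refine ENNReal.ofReal_le_ofReal (h2.trans_eq (by ring))

/-! ### Expected increments of a monotone function along Gaussian variables -/

lemma lintegral_mul_rpow_le_five {Ω : Type*} [MeasurableSpace Ω] {P : Measure Ω} {w₀ w : ℝ}
    (hw₀ : 0 ≤ w₀) (hw : 0 ≤ w) (hsum : w₀ + 4 * w = 1) {f₀ f₁ f₂ f₃ f₄ : Ω → ℝ≥0∞}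
    (h₀ : AEMeasurable f₀ P) (h₁ : AEMeasurable f₁ P) (h₂ : AEMeasurable f₂ P)
    (h₃ : AEMeasurable f₃ P) (h₄ : AEMeasurable f₄ P) :
    ∫⁻ ω, f₀ ω ^ w₀ * f₁ ω ^ w * f₂ ω ^ w * f₃ ω ^ w * f₄ ω ^ w ∂P ≤
      (∫⁻ ω, f₀ ω ∂P) ^ w₀ * (∫⁻ ω, f₁ ω ∂P) ^ w * (∫⁻ ω, f₂ ω ∂P) ^ w *
        (∫⁻ ω, f₃ ω ∂P) ^ w * (∫⁻ ω, f₄ ω ∂P) ^ w := by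
  have h := ENNReal.lintegral_prod_norm_pow_le (μ := P) Finset.univ
    (f := ![f₀, f₁, f₂, f₃, f₄]) (p := ![w₀, w, w, w, w])
    (by intro i _; fin_cases i <;> assumption)
    (by rw [Fin.sum_univ_five]; simp; linarith)
    (by intro i _; fin_cases i <;> assumption)
  simpa [Fin.prod_univ_five] using h

/-- The Hölder exponent given to each of the four factors other than the singular one. -/
noncomputable def holderWeight (γ : ℝ) : ℝ := (1 - γ) / 8

/-- The constant produced by Hölder's inequality in `lintegral_increment_le`. -/
noncomputable def incrementConst (p γ : ℝ) : ℝ≥0∞ :=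
  negMomentBound (2 * γ / (1 + γ)) ^ ((1 + γ) / 2) * gaussianAbsMoment (p / holderWeight γ) ^
    holderWeight γ * gaussianAbsMoment (γ / holderWeight γ) ^ holderWeight γ *
      expSqBound ^ holderWeight γ * expSqBound ^ holderWeight γ

lemma incrementConst_lt_top {p γ : ℝ} (hp : 0 < p) (hγ : 0 < γ) (hγ1 : γ < 1) :
    incrementConst p γ < ∞ := by
  have hw : 0 < holderWeight γ := by unfold holderWeight; linarith
  have h1 : 2 * γ / (1 + γ) < 1 := by rw [div_lt_one (by linarith)]; linarith
  have hγ' : 0 ≤ (1 + γ) / 2 := by linarith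
  refine ENNReal.mul_lt_top (ENNReal.mul_lt_top (ENNReal.mul_lt_top (ENNReal.mul_lt_top
    ?_ ?_) ?_) ?_) ?_
  · exact ENNReal.rpow_lt_top_of_nonneg hγ' (negMomentBound_lt_top h1).ne
  · exact ENNReal.rpow_lt_top_of_nonneg hw.le (gaussianAbsMoment_lt_top (by positivity)).ne
  · exact ENNReal.rpow_lt_top_of_nonneg hw.le (gaussianAbsMoment_lt_top (by positivity)).ne
  · exact ENNReal.rpow_lt_top_of_nonneg hw.le expSqBound_lt_top.ne
  · exact ENNReal.rpow_lt_top_of_nonneg hw.le expSqBound_lt_top.ne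

section

variable {Ω : Type*} [MeasurableSpace Ω] {P : Measure Ω}
  {X Y D : Ω → ℝ} {σX σY δ ρ τ : ℝ≥0} {p γ ε : ℝ}

/-- Hölder's inequality with a factor `|Y - u| ^ (-γ)`. Since `γ < 1` this factor may be raised to
a power larger than one and keep a finite expectation, bounded uniformly in `u`. -/
lemma lintegral_singular_le (hX : HasLaw X (gaussianReal 0 (σX ^ 2)) P)
    (hY : HasLaw Y (gaussianReal 0 (σY ^ 2)) P) (hD : HasLaw D (gaussianReal 0 (δ ^ 2)) P)
    (hYX : HasLaw (fun ω => Y ω - X ω) (gaussianReal 0 (ρ ^ 2)) P) (hσX : σX ≤ τ) (hσY : σY ≤ τ)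
    (hσY0 : 0 < σY) (hp : 0 < p) (hγ : 0 < γ) (hγ1 : γ < 1) (hε : 0 ≤ ε)
    (hετ : ε * p / holderWeight γ * τ ^ 2 ≤ 1 / 4) (u : ℝ) :
    ∫⁻ ω, ‖D ω‖ₑ ^ p * (ENNReal.ofReal (Real.exp (ε * p * X ω ^ 2)) *
        ENNReal.ofReal (Real.exp (ε * p * Y ω ^ 2)) *
          (‖Y ω - X ω‖ₑ ^ γ * ‖Y ω - u‖ₑ ^ (-γ))) ∂P ≤
      incrementConst p γ * ((δ : ℝ≥0∞) ^ p * (ρ : ℝ≥0∞) ^ γ * (σY : ℝ≥0∞) ^ (-γ)) := by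
  have hw : 0 < holderWeight γ := by unfold holderWeight; linarith
  set w := holderWeight γ with hwdef
  have hsum : (1 + γ) / 2 + 4 * w = 1 := by rw [hwdef, holderWeight]; ring
  have hXm := hX.aemeasurable
  have hYm := hY.aemeasurable
  have hDm := hD.aemeasurable
  have hexp : ∀ x : ℝ, ENNReal.ofReal (Real.exp (ε * p * x ^ 2)) =
      ENNReal.ofReal (Real.exp (ε * p / w * x ^ 2)) ^ w := fun x => by
    rw [ENNReal.ofReal_rpow_of_pos (Real.exp_pos _), ← Real.exp_mul]
    congr 2; field_simp
  have hpow : ∀ (a : ℝ≥0∞) (m : ℝ), a ^ m = (a ^ (m / w)) ^ w := fun a m => by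
    rw [← ENNReal.rpow_mul, div_mul_cancel₀ _ hw.ne']
  have hneg : ∀ a : ℝ≥0∞, a ^ (-γ) = (a ^ (-(2 * γ / (1 + γ)))) ^ ((1 + γ) / 2) := fun a => by
    rw [← ENNReal.rpow_mul]; congr 1; field_simp
  have hexpσ : ∀ {σ : ℝ≥0}, σ ≤ τ → ε * p / w * (σ : ℝ) ^ 2 ≤ 1 / 4 := fun {σ} h =>
    le_trans (mul_le_mul_of_nonneg_left (by gcongr) (by positivity)) hετ
  calc _ = ∫⁻ ω, (‖Y ω - u‖ₑ ^ (-(2 * γ / (1 + γ)))) ^ ((1 + γ) / 2) *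
          (‖D ω‖ₑ ^ (p / w)) ^ w * (‖Y ω - X ω‖ₑ ^ (γ / w)) ^ w *
          ENNReal.ofReal (Real.exp (ε * p / w * X ω ^ 2)) ^ w *
          ENNReal.ofReal (Real.exp (ε * p / w * Y ω ^ 2)) ^ w ∂P := by
        refine lintegral_congr fun ω => ?_
        rw [← hneg, ← hpow, ← hpow, ← hexp, ← hexp]
        ring
    _ ≤ (∫⁻ ω, ‖Y ω - u‖ₑ ^ (-(2 * γ / (1 + γ))) ∂P) ^ ((1 + γ) / 2) *
          (∫⁻ ω, ‖D ω‖ₑ ^ (p / w) ∂P) ^ w * (∫⁻ ω, ‖Y ω - X ω‖ₑ ^ (γ / w) ∂P) ^ w *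
          (∫⁻ ω, ENNReal.ofReal (Real.exp (ε * p / w * X ω ^ 2)) ∂P) ^ w *
          (∫⁻ ω, ENNReal.ofReal (Real.exp (ε * p / w * Y ω ^ 2)) ∂P) ^ w := by
        refine lintegral_mul_rpow_le_five (by linarith) hw.le hsum ?_ ?_ ?_ ?_ ?_ <;> fun_prop
    _ ≤ ((σY : ℝ≥0∞) ^ (-(2 * γ / (1 + γ))) * negMomentBound (2 * γ / (1 + γ))) ^ ((1 + γ) / 2) *
          ((δ : ℝ≥0∞) ^ (p / w) * gaussianAbsMoment (p / w)) ^ w *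
          ((ρ : ℝ≥0∞) ^ (γ / w) * gaussianAbsMoment (γ / w)) ^ w *
          expSqBound ^ w * expSqBound ^ w := by
        gcongr
        · exact hY.lintegral_sub_rpow_neg_le hσY0 (by positivity) u
        · exact (hD.lintegral_enorm_rpow (by positivity)).le
        · exact (hYX.lintegral_enorm_rpow (by positivity)).le
        · exact hX.lintegral_exp_mul_sq_le (hexpσ hσX)
        · exact hY.lintegral_exp_mul_sq_le (hexpσ hσY)
    _ = _ := by
        rw [ENNReal.mul_rpow_of_nonneg _ _ (by linarith), ENNReal.mul_rpow_of_nonneg _ _ hw.le,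
          ENNReal.mul_rpow_of_nonneg _ _ hw.le, ← hneg, ← hpow, ← hpow, incrementConst, ← hwdef]
        ring

/-- The moment estimate behind the theorem: for centred Gaussian `D`, `X`, `Y`, the expectation of
`|D (F(Y) - F(X))| ^ p` gains a factor `(ρ / σY) ^ γ`, where `ρ` and `σY` are the standard
deviations of `Y - X` and `Y`. -/
lemma lintegral_increment_le [SFinite P] {F : ℝ → ℝ} (hF : Monotone F)
    (hX : HasLaw X (gaussianReal 0 (σX ^ 2)) P)
    (hY : HasLaw Y (gaussianReal 0 (σY ^ 2)) P) (hD : HasLaw D (gaussianReal 0 (δ ^ 2)) P)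
    (hYX : HasLaw (fun ω => Y ω - X ω) (gaussianReal 0 (ρ ^ 2)) P) (hσX : σX ≤ τ) (hσY : σY ≤ τ)
    (hσY0 : 0 < σY) (hp : 1 ≤ p) (hγ : 0 < γ) (hγ1 : γ < 1) (hε : 0 ≤ ε)
    (hετ : ε * p / holderWeight γ * τ ^ 2 ≤ 1 / 4) (hfin : hF.gaussianTilt ε Set.univ < ∞) :
    ∫⁻ ω, ‖D ω * (F (Y ω) - F (X ω))‖ₑ ^ p ∂P ≤
      hF.gaussianTilt ε Set.univ ^ p * incrementConst p γ *
        ((δ : ℝ≥0∞) ^ p * (ρ : ℝ≥0∞) ^ γ * (σY : ℝ≥0∞) ^ (-γ)) := by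
  have hXm := hX.aemeasurable
  have hYm := hY.aemeasurable
  have hDm := hD.aemeasurable
  set ν := hF.gaussianTilt ε with hν
  have : IsFiniteMeasure ν := ⟨hfin⟩
  set g : Ω → ℝ → ℝ≥0∞ := fun ω u =>
    ‖D ω‖ₑ ^ p * (ENNReal.ofReal (Real.exp (ε * p * X ω ^ 2)) *
      ENNReal.ofReal (Real.exp (ε * p * Y ω ^ 2)) *
        (‖Y ω - X ω‖ₑ ^ γ * ‖Y ω - u‖ₑ ^ (-γ))) with hg
  have hgm : AEMeasurable (Function.uncurry g) (P.prod ν) := by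
    have h1 : AEMeasurable (fun z : Ω × ℝ => X z.1) (P.prod ν) := hXm.comp_fst
    have h2 : AEMeasurable (fun z : Ω × ℝ => Y z.1) (P.prod ν) := hYm.comp_fst
    have h3 : AEMeasurable (fun z : Ω × ℝ => D z.1) (P.prod ν) := hDm.comp_fst
    simp only [Function.uncurry_def, hg]
    fun_prop
  have hcne : ν Set.univ ^ (p - 1) ≠ ∞ :=
    ENNReal.rpow_ne_top_of_nonneg (by linarith) hfin.ne
  calc _ ≤ ∫⁻ ω, ν Set.univ ^ (p - 1) * ∫⁻ u, g ω u ∂ν ∂P := by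
        refine lintegral_mono fun ω => ?_
        rw [enorm_mul, ENNReal.mul_rpow_of_nonneg _ _ (by linarith)]
        refine (mul_le_mul_right (hF.enorm_sub_rpow_le hε hp hγ.le (X ω) (Y ω)) _).trans_eq ?_
        simp only [hg]
        rw [lintegral_const_mul _ (by fun_prop), lintegral_const_mul _ (by fun_prop),
          lintegral_const_mul _ (by fun_prop)]
        ring
    _ = ν Set.univ ^ (p - 1) * ∫⁻ u, ∫⁻ ω, g ω u ∂P ∂ν := by
        rw [lintegral_const_mul' _ _ hcne, lintegral_lintegral_swap hgm]
    _ ≤ ν Set.univ ^ (p - 1) * ∫⁻ _, incrementConst p γ *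
          ((δ : ℝ≥0∞) ^ p * (ρ : ℝ≥0∞) ^ γ * (σY : ℝ≥0∞) ^ (-γ)) ∂ν := by
        refine mul_le_mul_right (lintegral_mono fun u => ?_) _
        exact lintegral_singular_le hX hY hD hYX hσX hσY hσY0 (by linarith) hγ hγ1 hε hετ u
    _ = _ := by
        rw [lintegral_const]
        have : ν Set.univ ^ p = ν Set.univ ^ (p - 1) * ν Set.univ := by
          conv_rhs => rw [← ENNReal.rpow_one (ν Set.univ), ← ENNReal.rpow_mul, one_mul,
            ← ENNReal.rpow_add_of_nonneg _ _ (by linarith) zero_le_one, sub_add_cancel]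
        rw [this]
        ring

end

/-! ### Fractional Brownian motion -/

namespace IsFractionalBrownianMotion

variable {Ω : Type*} [MeasurableSpace Ω] {P : Measure Ω} {H : ℝ} {B : ℝ≥0 → Ω → ℝ}

lemma aemeasurable (hB : IsFractionalBrownianMotion H B P) (t : ℝ≥0) : AEMeasurable (B t) P :=
  hB.isGaussianProcess.aemeasurable t

lemma variance_eq (hB : IsFractionalBrownianMotion H B P) (hH : 0 < H) (t : ℝ≥0) :
    Var[B t; P] = (t : ℝ) ^ (2 * H) := by
  rw [← covariance_self (hB.aemeasurable t), hB.covariance_eq, sub_self, abs_zero,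
    Real.zero_rpow (by positivity)]
  ring

lemma hasLaw_eval (hB : IsFractionalBrownianMotion H B P) (hH : 0 < H) (t : ℝ≥0) :
    HasLaw (B t) (gaussianReal 0 ((t ^ H) ^ 2)) P where
  aemeasurable := hB.aemeasurable t
  map_eq := by
    rw [(hB.isGaussianProcess.hasGaussianLaw_eval t).map_eq_gaussianReal, hB.mean_zero,
      hB.variance_eq hH]
    congr 1
    ext
    rw [Real.coe_toNNReal _ (by positivity), NNReal.coe_pow, NNReal.coe_rpow, mul_comm,
      Real.rpow_mul t.coe_nonneg, Real.rpow_two]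

lemma hasLaw_increment (hB : IsFractionalBrownianMotion H B P) (hH : 0 < H) {a b : ℝ≥0}
    (hab : a ≤ b) :
    HasLaw (fun ω => B b ω - B a ω) (gaussianReal 0 (((b - a) ^ H) ^ 2)) P where
  aemeasurable := (hB.aemeasurable b).sub (hB.aemeasurable a)
  map_eq := by
    have := hB.isGaussianProcess.isProbabilityMeasure
    have ha := hB.isGaussianProcess.hasGaussianLaw_eval a
    have hb := hB.isGaussianProcess.hasGaussianLaw_eval b
    rw [hB.isGaussianProcess.hasGaussianLaw_fun_sub.map_eq_gaussianReal,
      integral_sub hb.integrable ha.integrable, hB.mean_zero, hB.mean_zero, sub_zero,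
      variance_fun_sub hb.memLp_two ha.memLp_two, hB.variance_eq hH, hB.variance_eq hH,
      hB.covariance_eq]
    congr 1
    ext
    have hr : (0 : ℝ) ≤ b - a := sub_nonneg.2 hab
    rw [NNReal.coe_pow, NNReal.coe_rpow, NNReal.coe_sub hab, abs_sub_comm, abs_of_nonneg hr,
      ← Real.rpow_natCast, ← Real.rpow_mul hr, Real.coe_toNNReal']
    rw [show (b : ℝ) ^ (2 * H) - 2 * (((a : ℝ) ^ (2 * H) + (b : ℝ) ^ (2 * H)
      - ((b : ℝ) - a) ^ (2 * H)) / 2) + (a : ℝ) ^ (2 * H) = ((b : ℝ) - a) ^ (2 * H) by ring,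
      max_eq_left (Real.rpow_nonneg hr _)]
    push_cast
    ring_nf

lemma eval_zero_ae (hB : IsFractionalBrownianMotion H B P) (hH : 0 < H) : B 0 =ᵐ[P] 0 := by
  have := hB.isGaussianProcess.isProbabilityMeasure
  have h := ae_eq_integral_of_variance_eq_zero
    (hB.isGaussianProcess.hasGaussianLaw_eval 0).memLp_two
    (by rw [hB.variance_eq hH, NNReal.coe_zero, Real.zero_rpow (by positivity)])
  filter_upwards [h] with ω hω
  simpa [hB.mean_zero] using hω

/-- The `L_p` norm of the increment of the path over `[a, b]` times the increment of `F` along the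
path over `[r, b]`. The factor `b ^ (-H / q)` comes from the negative moments of `B b - u`, which are
uniform in the level `u`. -/
lemma eLpNorm_increment_le (hB : IsFractionalBrownianMotion H B P) (hH : 0 < H) {F : ℝ → ℝ}
    (hF : Monotone F) {p q ε : ℝ} (hp : 1 ≤ p) (hpq : p < q) (hε : 0 ≤ ε)
    (hfin : hF.gaussianTilt ε Set.univ < ∞) {T a r b : ℝ≥0} (har : a ≤ r) (hrb : r ≤ b)
    (hb : 0 < b) (hbT : b ≤ T)
    (hεT : ε * p / holderWeight (p / q) * ((T ^ H : ℝ≥0) : ℝ) ^ 2 ≤ 1 / 4) :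
    eLpNorm (fun ω => (B b ω - B a ω) * (F (B b ω) - F (B r ω))) (ENNReal.ofReal p) P ≤
      (hF.gaussianTilt ε Set.univ ^ p * incrementConst p (p / q)) ^ (1 / p) *
        ENNReal.ofReal (((b : ℝ) - a) ^ (H + H / q) * (b : ℝ) ^ (-(H / q))) := by
  have := hB.isGaussianProcess.isProbabilityMeasure
  have hp0 : 0 < p := by linarith
  have hq0 : 0 < q := by linarith
  have hab := har.trans hrb
  have hr0 : (0 : ℝ) ≤ b - a := sub_nonneg.2 hab
  have key := lintegral_increment_le hF (hB.hasLaw_eval hH r) (hB.hasLaw_eval hH b)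
    (hB.hasLaw_increment hH hab) (hB.hasLaw_increment hH hrb)
    (NNReal.rpow_le_rpow (hrb.trans hbT) hH.le) (NNReal.rpow_le_rpow hbT hH.le)
    (NNReal.rpow_pos hb) hp (γ := p / q) (by positivity) ((div_lt_one hq0).2 hpq) hε hεT hfin
  rw [eLpNorm_eq_lintegral_rpow_enorm_toReal (by simpa using hp0) ENNReal.ofReal_ne_top,
    ENNReal.toReal_ofReal hp0.le]
  refine (ENNReal.rpow_le_rpow key (by positivity)).trans ?_
  rw [ENNReal.mul_rpow_of_nonneg _ _ (by positivity)]
  refine mul_le_mul_right ?_ _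
  have h1 : (((b - r) ^ H : ℝ≥0) : ℝ≥0∞) ^ (p / q) ≤ (((b - a) ^ H : ℝ≥0) : ℝ≥0∞) ^ (p / q) := by
    gcongr
  calc _ ≤ ((((b - a) ^ H : ℝ≥0) : ℝ≥0∞) ^ p * (((b - a) ^ H : ℝ≥0) : ℝ≥0∞) ^ (p / q) *
          ((b ^ H : ℝ≥0) : ℝ≥0∞) ^ (-(p / q))) ^ (1 / p) := by gcongr
    _ = (((b - a) ^ (H + H / q) * b ^ (-(H / q)) : ℝ≥0) : ℝ≥0∞) := by
        rw [← ENNReal.coe_rpow_of_nonneg _ hp0.le, ← ENNReal.coe_rpow_of_nonneg _ (by positivity),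
          ← ENNReal.coe_rpow_of_ne_zero (NNReal.rpow_pos hb).ne', ← ENNReal.coe_mul,
          ← ENNReal.coe_mul, ← ENNReal.coe_rpow_of_nonneg _ (by positivity)]
        congr 1
        rw [NNReal.mul_rpow, NNReal.mul_rpow, ← NNReal.rpow_mul, ← NNReal.rpow_mul,
          ← NNReal.rpow_mul, ← NNReal.rpow_mul, ← NNReal.rpow_mul, ← NNReal.rpow_mul,
          ← NNReal.rpow_add_of_nonneg _ (by positivity) (by positivity)]
        congr 2 <;> field_simp
    _ = _ := by
        rw [ENNReal.coe_nnreal_eq]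
        congr 1
        rw [NNReal.coe_mul, NNReal.coe_rpow, NNReal.coe_rpow, NNReal.coe_sub hab]

end IsFractionalBrownianMotion

/-! ### Sums over partitions -/

lemma Fin.sum_succ_sub_castSucc {n : ℕ} (f : Fin (n + 1) → ℝ) :
    ∑ i : Fin n, (f i.succ - f i.castSucc) = f (Fin.last n) - f 0 := by
  rw [Finset.sum_sub_distrib]
  linarith [Fin.sum_univ_succ f, Fin.sum_univ_castSucc f]

lemma sub_mul_rpow_neg_le {a b α : ℝ} (ha : 0 ≤ a) (hab : a < b) (hα : 0 ≤ α) (hα1 : α < 1) :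
    (b - a) * b ^ (-α) ≤ (b ^ (1 - α) - a ^ (1 - α)) / (1 - α) := by
  have hb : 0 < b := ha.trans_lt hab
  have h := rpow_one_add_le_one_add_mul_self (s := a / b - 1) (p := 1 - α)
    (by have := div_nonneg ha hb.le; linarith) (by linarith) (by linarith)
  rw [add_sub_cancel, Real.div_rpow ha hb.le, div_le_iff₀ (by positivity)] at h
  have h2 : b ^ (1 - α) = b * b ^ (-α) := by
    rw [sub_eq_add_neg, Real.rpow_add hb, Real.rpow_one]
  rw [le_div_iff₀ (by linarith)]
  have h3 : (1 + (1 - α) * (a / b - 1)) * b ^ (1 - α) =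
      b ^ (1 - α) - (b - a) * b ^ (-α) * (1 - α) := by
    rw [h2]; field_simp; ring
  linarith

namespace IsTimePartition

variable {T : ℝ≥0} {n : ℕ} {t : Fin (n + 1) → ℝ≥0}

lemma castSucc_lt_succ (ht : IsTimePartition T t) (i : Fin n) : t i.castSucc < t i.succ :=
  ht.strictMono i.castSucc_lt_succ

lemma sub_le_timeMesh (ht : IsTimePartition T t) (i : Fin n) :
    (t i.succ : ℝ) - t i.castSucc ≤ timeMesh t := by
  rw [← NNReal.coe_sub (ht.castSucc_lt_succ i).le, NNReal.coe_le_coe]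
  exact Finset.le_sup (f := fun i : Fin n => t i.succ - t i.castSucc) (Finset.mem_univ i)

lemma succ_le (ht : IsTimePartition T t) (i : Fin n) : t i.succ ≤ T :=
  ht.last ▸ ht.strictMono.monotone (Fin.le_last _)

/-- Comparison of a Riemann sum of `∫ x ^ (-α) dx`, with right end points as tags, with the
integral: the summands telescope. -/
lemma sum_rpow_mul_rpow_neg_le (ht : IsTimePartition T t) {α β : ℝ} (hα : 0 ≤ α) (hα1 : α < 1)
    (hβ : 0 ≤ β) :
    ∑ i : Fin n, ((t i.succ : ℝ) - t i.castSucc) ^ (1 + β) * (t i.succ : ℝ) ^ (-α) ≤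
      (T : ℝ) ^ (1 - α) / (1 - α) * (timeMesh t : ℝ) ^ β := by
  calc _ ≤ ∑ i : Fin n, ((t i.succ : ℝ) ^ (1 - α) - (t i.castSucc : ℝ) ^ (1 - α)) *
          ((timeMesh t : ℝ) ^ β / (1 - α)) := by
        refine Finset.sum_le_sum fun i _ => ?_
        have hlt : (t i.castSucc : ℝ) < t i.succ := ht.castSucc_lt_succ i
        have hpos : (0 : ℝ) < (t i.succ : ℝ) - t i.castSucc := by linarith
        have h1 := sub_mul_rpow_neg_le (t i.castSucc).2 hlt hα hα1
        have h2 : ((t i.succ : ℝ) - t i.castSucc) ^ β ≤ (timeMesh t : ℝ) ^ β :=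
          Real.rpow_le_rpow hpos.le (ht.sub_le_timeMesh i) hβ
        calc _ = (((t i.succ : ℝ) - t i.castSucc) * (t i.succ : ℝ) ^ (-α)) *
              ((t i.succ : ℝ) - t i.castSucc) ^ β := by
              rw [Real.rpow_add hpos, Real.rpow_one]; ring
          _ ≤ (((t i.succ : ℝ) ^ (1 - α) - (t i.castSucc : ℝ) ^ (1 - α)) / (1 - α)) *
              (timeMesh t : ℝ) ^ β :=
              mul_le_mul h1 h2 (by positivity) (le_trans (by positivity) h1)
          _ = _ := by ring
    _ = (T : ℝ) ^ (1 - α) / (1 - α) * (timeMesh t : ℝ) ^ β := by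
        rw [← Finset.sum_mul, Fin.sum_succ_sub_castSucc (fun i => (t i : ℝ) ^ (1 - α)), ht.first,
          ht.last, NNReal.coe_zero, Real.zero_rpow (by linarith)]
        ring

end IsTimePartition

/-! ### The Riemann-Stieltjes integral -/

section

variable {Ω : Type*} {F : ℝ → ℝ} {B : ℝ≥0 → Ω → ℝ}

lemma Monotone.aestronglyMeasurable_integral_comp [MeasurableSpace Ω] {P : Measure Ω}
    (hF : Monotone F) {X : Ω → ℝ} (hX : AEMeasurable X P) :
    AEStronglyMeasurable (fun ω => ∫ x in (0 : ℝ)..X ω, F x) P :=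
  (Measurable.comp_aemeasurable (intervalIntegral.continuous_primitive
    (fun _ _ => hF.intervalIntegrable) 0).measurable hX).aestronglyMeasurable

/-- The primitive of `F` along a process splits over the partition into the primitives over the
increments. -/
lemma IsTimePartition.integral_sub_stieltjesSum {T : ℝ≥0} {n : ℕ} {t : Fin (n + 1) → ℝ≥0}
    (ht : IsTimePartition T t) (hF : Monotone F) (s : Fin n → ℝ≥0) {ω : Ω} (h0 : B 0 ω = 0) :
    (∫ x in (0 : ℝ)..B T ω, F x) - stieltjesSum (fun t ω => F (B t ω)) B t s ω =
      ∑ i : Fin n, ((∫ x in B (t i.castSucc) ω..B (t i.succ) ω, F x) -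
        F (B (s i) ω) * (B (t i.succ) ω - B (t i.castSucc) ω)) := by
  have h1 : ∀ i : Fin n, (∫ x in B (t i.castSucc) ω..B (t i.succ) ω, F x) =
      (∫ x in (0 : ℝ)..B (t i.succ) ω, F x) - ∫ x in (0 : ℝ)..B (t i.castSucc) ω, F x := fun i =>
    (intervalIntegral.integral_interval_sub_left hF.intervalIntegrable hF.intervalIntegrable).symm
  rw [Finset.sum_sub_distrib, Finset.sum_congr rfl fun i _ => h1 i,
    Fin.sum_succ_sub_castSucc (fun i => ∫ x in (0 : ℝ)..B (t i) ω, F x), ht.first, ht.last, h0]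
  simp [stieltjesSum]

end

/-- The parameter `ε` of the tilted measure: small enough for `exp (ε p B_t ^ 2)`, `t ≤ T`, to have
the moments needed in Hölder's inequality. -/
noncomputable def tiltParam (p q H : ℝ) (T : ℝ≥0) : ℝ :=
  holderWeight (p / q) / (4 * p * ((T ^ H : ℝ≥0) : ℝ) ^ 2)

/-- The rate constant: a function of `F`, `T`, `H`, `p`, `q` only. The factor two accounts for the
two oscillations in `Monotone.enorm_integral_sub_le`. -/
noncomputable def Monotone.rateConst {F : ℝ → ℝ} (hF : Monotone F) (T : ℝ≥0) (H p q : ℝ) : ℝ :=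
  2 * ((hF.gaussianTilt (tiltParam p q H T) Set.univ ^ p * incrementConst p (p / q)) ^
    (1 / p)).toReal / (1 - H / q)

/-- The rate of convergence, for arbitrary tags. -/
theorem IsFractionalBrownianMotion.eLpNorm_integral_sub_stieltjesSum_le {F : ℝ → ℝ}
    (hF : Monotone F)
    (hμ : ∀ ε : ℝ, 0 < ε →
      ∫⁻ u, ENNReal.ofReal (Real.exp (-ε * u ^ 2)) ∂hF.stieltjesFunction.measure < ∞)
    {T : ℝ≥0} (hT : 0 < T) {H : ℝ} (hH : H ∈ Set.Ioo (0 : ℝ) 1)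
    {p q : ℝ} (hp : 1 ≤ p) (hq : q ∈ Set.Ioo p (H / (1 - H)))
    {Ω : Type*} [MeasurableSpace Ω] {P : Measure Ω} {B : ℝ≥0 → Ω → ℝ}
    (hB : IsFractionalBrownianMotion H B P) {n : ℕ} {t : Fin (n + 1) → ℝ≥0}
    (ht : IsTimePartition T t) {s : Fin n → ℝ≥0}
    (hs : ∀ i, s i ∈ Set.Icc (t i.castSucc) (t i.succ)) :
    eLpNorm (fun ω => (∫ x in (0 : ℝ)..B T ω, F x) - stieltjesSum (fun t ω => F (B t ω)) B t s ω)
        (ENNReal.ofReal p) P ≤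
      ENNReal.ofReal (hF.rateConst T H p q * (T : ℝ) ^ (1 - H / q) *
        (timeMesh t : ℝ) ^ (H / q + H - 1)) := by
  obtain ⟨hH0, hH1⟩ := hH
  obtain ⟨hpq, hqH⟩ := hq
  have hp0 : 0 < p := by linarith
  have hq0 : 0 < q := by linarith
  have hα1 : H / q < 1 := by rw [div_lt_one hq0]; linarith
  have hβ : 0 ≤ H / q + H - 1 := by
    rw [lt_div_iff₀ (by linarith)] at hqH
    have : 1 - H ≤ H / q := by rw [le_div_iff₀ hq0]; linarith
    linarith
  have hγ1 : p / q < 1 := (div_lt_one hq0).2 hpq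
  have hτ : (0 : ℝ) < (T ^ H : ℝ≥0) := NNReal.rpow_pos hT
  have hw : 0 < holderWeight (p / q) := by unfold holderWeight; linarith
  have hε : 0 < tiltParam p q H T := by unfold tiltParam; positivity
  have hεT : tiltParam p q H T * p / holderWeight (p / q) * ((T ^ H : ℝ≥0) : ℝ) ^ 2 ≤ 1 / 4 := by
    rw [tiltParam]; apply le_of_eq; field_simp
  have hfin : hF.gaussianTilt (tiltParam p q H T) Set.univ < ∞ := by
    rw [Monotone.gaussianTilt, withDensity_apply _ MeasurableSet.univ, Measure.restrict_univ]
    exact hμ _ hε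
  set K := (hF.gaussianTilt (tiltParam p q H T) Set.univ ^ p * incrementConst p (p / q)) ^ (1 / p)
    with hK
  have hKtop : K ≠ ∞ := ENNReal.rpow_ne_top_of_nonneg (by positivity) (ENNReal.mul_ne_top
    (ENNReal.rpow_ne_top_of_nonneg hp0.le hfin.ne)
    (incrementConst_lt_top hp0 (by positivity) hγ1).ne)
  have hp1 : (1 : ℝ≥0∞) ≤ ENNReal.ofReal p := by simpa using hp
  have hBm := hB.aemeasurable
  have hFm := hF.measurable
  set x : Fin n → ℝ := fun i => ((t i.succ : ℝ) - t i.castSucc) ^ (1 + (H / q + H - 1)) *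
    (t i.succ : ℝ) ^ (-(H / q)) with hx
  have hx0 : ∀ i, 0 ≤ x i := fun i => by
    have : (0 : ℝ) ≤ (t i.succ : ℝ) - t i.castSucc := sub_nonneg.2 (ht.castSucc_lt_succ i).le
    positivity
  have hterm : ∀ (i : Fin n) (r : ℝ≥0), r ∈ Set.Icc (t i.castSucc) (t i.succ) →
      eLpNorm (fun ω => (B (t i.succ) ω - B (t i.castSucc) ω) *
        (F (B (t i.succ) ω) - F (B r ω))) (ENNReal.ofReal p) P ≤ K * ENNReal.ofReal (x i) := by
    intro i r hr
    have h := hB.eLpNorm_increment_le hH0 hF hp hpq hε.le hfin hr.1 hr.2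
      (zero_le.trans_lt (ht.castSucc_lt_succ i)) (ht.succ_le i) hεT
    rwa [show H + H / q = 1 + (H / q + H - 1) by ring] at h
  set R : Fin n → Ω → ℝ := fun i ω => (∫ x in B (t i.castSucc) ω..B (t i.succ) ω, F x) -
    F (B (s i) ω) * (B (t i.succ) ω - B (t i.castSucc) ω) with hR
  have hRm : ∀ i, AEStronglyMeasurable (R i) P := fun i => by
    have h1 : ∀ ω, (∫ x in B (t i.castSucc) ω..B (t i.succ) ω, F x) =
        (∫ x in (0 : ℝ)..B (t i.succ) ω, F x) - ∫ x in (0 : ℝ)..B (t i.castSucc) ω, F x :=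
      fun ω => (intervalIntegral.integral_interval_sub_left hF.intervalIntegrable
        hF.intervalIntegrable).symm
    simp only [hR, h1]
    refine ((hF.aestronglyMeasurable_integral_comp (hBm _)).sub
      (hF.aestronglyMeasurable_integral_comp (hBm _))).sub (AEMeasurable.aestronglyMeasurable ?_)
    exact (hFm.comp_aemeasurable (hBm _)).mul ((hBm _).sub (hBm _))
  have hRle : ∀ i, eLpNorm (R i) (ENNReal.ofReal p) P ≤ 2 * K * ENNReal.ofReal (x i) := fun i => by
    have hm : ∀ r, AEStronglyMeasurable (fun ω => (B (t i.succ) ω - B (t i.castSucc) ω) *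
        (F (B (t i.succ) ω) - F (B r ω))) P := fun r =>
      (((hBm _).sub (hBm _)).mul ((hFm.comp_aemeasurable (hBm _)).sub
        (hFm.comp_aemeasurable (hBm _)))).aestronglyMeasurable
    calc eLpNorm (R i) (ENNReal.ofReal p) P
        ≤ eLpNorm ((fun ω => ‖(B (t i.succ) ω - B (t i.castSucc) ω) *
            (F (B (t i.succ) ω) - F (B (t i.castSucc) ω))‖ₑ) +
            fun ω => ‖(B (t i.succ) ω - B (t i.castSucc) ω) *
              (F (B (t i.succ) ω) - F (B (s i) ω))‖ₑ) (ENNReal.ofReal p) P :=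
          eLpNorm_mono_enorm fun ω => by
            simpa using hF.enorm_integral_sub_le (B (t i.castSucc) ω) (B (t i.succ) ω) (B (s i) ω)
      _ ≤ K * ENNReal.ofReal (x i) + K * ENNReal.ofReal (x i) := by
          refine (eLpNorm_add_le (hm _).enorm.aestronglyMeasurable
            (hm _).enorm.aestronglyMeasurable hp1).trans (add_le_add ?_ ?_)
          · rw [eLpNorm_enorm]
            exact hterm i _ ⟨le_rfl, (ht.castSucc_lt_succ i).le⟩
          · rw [eLpNorm_enorm]
            exact hterm i _ (hs i)
      _ = _ := by ring
  calc _ = eLpNorm (∑ i, R i) (ENNReal.ofReal p) P := by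
        refine eLpNorm_congr_ae ?_
        filter_upwards [hB.eval_zero_ae hH0] with ω h0
        rw [ht.integral_sub_stieltjesSum hF s h0, Finset.sum_apply]
    _ ≤ ∑ i, eLpNorm (R i) (ENNReal.ofReal p) P := eLpNorm_sum_le (fun i _ => hRm i) hp1
    _ ≤ ∑ i, 2 * K * ENNReal.ofReal (x i) := Finset.sum_le_sum fun i _ => hRle i
    _ = ENNReal.ofReal (2 * K.toReal * ∑ i, x i) := by
        rw [← Finset.mul_sum, ENNReal.ofReal_mul (by positivity),
          ENNReal.ofReal_mul (by norm_num), ENNReal.ofReal_toReal hKtop,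
          ENNReal.ofReal_sum_of_nonneg fun i _ => hx0 i]
        simp
    _ ≤ _ := by
        refine ENNReal.ofReal_le_ofReal ?_
        refine (mul_le_mul_of_nonneg_left (ht.sum_rpow_mul_rpow_neg_le (by positivity) hα1 hβ)
          (by positivity)).trans_eq ?_
        rw [Monotone.rateConst, ← hK]
        ring

/-- The one-step partition of `[0, T]`. -/
lemma isTimePartition_pair {T : ℝ≥0} (hT : 0 < T) : IsTimePartition T (n := 1) ![0, T] where
  first := rfl
  last := rfl
  strictMono := by
    intro i j hij
    fin_cases i <;> fin_cases j <;> simp_all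

/-- Comparison with the Riemann-Stieltjes sum of the one-step partition, which is almost surely
`F 0 * B T`. -/
lemma IsFractionalBrownianMotion.memLp_integral {F : ℝ → ℝ} (hF : Monotone F)
    (hμ : ∀ ε : ℝ, 0 < ε →
      ∫⁻ u, ENNReal.ofReal (Real.exp (-ε * u ^ 2)) ∂hF.stieltjesFunction.measure < ∞)
    {T : ℝ≥0} (hT : 0 < T) {H : ℝ} (hH : H ∈ Set.Ioo (0 : ℝ) 1)
    {p q : ℝ} (hp : 1 ≤ p) (hq : q ∈ Set.Ioo p (H / (1 - H)))
    {Ω : Type*} [MeasurableSpace Ω] {P : Measure Ω} {B : ℝ≥0 → Ω → ℝ}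
    (hB : IsFractionalBrownianMotion H B P) :
    MemLp (fun ω => ∫ x in (0 : ℝ)..B T ω, F x) (ENNReal.ofReal p) P := by
  set S := stieltjesSum (fun t ω => F (B t ω)) B ![0, T] (fun _ : Fin 1 => (0 : ℝ≥0)) with hS
  have h1 : MemLp S (ENNReal.ofReal p) P := by
    have h2 := ((hB.isGaussianProcess.hasGaussianLaw_eval T).memLp
      (p := ENNReal.ofReal p) ENNReal.ofReal_ne_top).const_mul (F 0)
    refine (memLp_congr_ae ?_).1 h2
    filter_upwards [hB.eval_zero_ae hH.1] with ω h0
    simp only [Pi.zero_apply] at h0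
    simp [hS, stieltjesSum, h0]
  have h3 := hB.eLpNorm_integral_sub_stieltjesSum_le hF hμ hT hH hp hq (isTimePartition_pair hT)
    (s := fun _ => 0) (fun i => by fin_cases i; simp)
  have h4 : MemLp (fun ω => (∫ x in (0 : ℝ)..B T ω, F x) - S ω) (ENNReal.ofReal p) P :=
    ⟨(hF.aestronglyMeasurable_integral_comp (hB.aemeasurable T)).sub h1.1,
      h3.trans_lt ENNReal.ofReal_lt_top⟩
  convert h4.add h1 using 1
  ext ω
  simp

/-- The constant `C q` is chosen before the probability space and the fractional Brownian motion:
it depends on `p`, `q`, `T`, `H` and `F` only. The measure `dF` is the Stieltjes measure of `F`. -/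
theorem theorem3 (F : ℝ → ℝ) (hF : Monotone F)
    (hμ : ∀ ε : ℝ, 0 < ε →
      ∫⁻ u, ENNReal.ofReal (Real.exp (-ε * u ^ 2)) ∂hF.stieltjesFunction.measure < ∞)
    (T : ℝ≥0) (hT : 0 < T) (H : ℝ) (hH : H ∈ Set.Ioo (1 / 2 : ℝ) 1)
    (p : ℝ) (hp : p ∈ Set.Ico 1 (H / (1 - H))) :
    ∃ C : ℝ → ℝ, ∀ (Ω : Type*) (mΩ : MeasurableSpace Ω) (P : Measure Ω),
      IsProbabilityMeasure P → ∀ B : ℝ≥0 → Ω → ℝ, IsFractionalBrownianMotion H B P →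
        ∃ I : Ω → ℝ,
          IsStieltjesIntegral P (ENNReal.ofReal p) (fun t ω => F (B t ω)) B T I ∧
          (∀ᵐ ω ∂P, ∫ x in (0 : ℝ)..B T ω, F x = I ω) ∧
          ∀ q ∈ Set.Ioo p (H / (1 - H)), ∀ (n : ℕ) (t : Fin (n + 1) → ℝ≥0),
            IsTimePartition T t →
              eLpNorm (fun ω => I ω - forwardSum (fun t ω => F (B t ω)) B t ω)
                  (ENNReal.ofReal p) P ≤
                ENNReal.ofReal
                  (C q * (T : ℝ) ^ (1 - H / q) * (timeMesh t : ℝ) ^ (H / q + H - 1)) := by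
  have hH' : H ∈ Set.Ioo (0 : ℝ) 1 := ⟨by linarith [hH.1], hH.2⟩
  refine ⟨hF.rateConst T H p, fun Ω mΩ P _ B hB => ⟨fun ω => ∫ x in (0 : ℝ)..B T ω, F x,
    ⟨?_, ?_⟩, by simp, fun q hq n t ht => ?_⟩⟩
  · obtain ⟨q, hq⟩ := exists_between hp.2
    exact hB.memLp_integral hF hμ hT hH' hp.1 hq
  · intro ε hε
    obtain ⟨q, hq⟩ := exists_between hp.2
    have hq0 : 0 < q := by linarith [hp.1, hq.1]
    have hβ : 0 < H / q + H - 1 := by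
      have h := hq.2
      rw [lt_div_iff₀ (by linarith [hH.2])] at h
      have : 1 - H < H / q := by rw [lt_div_iff₀ hq0]; linarith
      linarith
    -- The bound on the error, as a function of the mesh, is continuous and vanishes at zero.
    have hlim : Filter.Tendsto (fun d : ℝ≥0 => ENNReal.ofReal (hF.rateConst T H p q *
        (T : ℝ) ^ (1 - H / q) * (d : ℝ) ^ (H / q + H - 1))) (nhds 0) (nhds 0) := by
      have hc : Continuous (fun d : ℝ≥0 => ENNReal.ofReal (hF.rateConst T H p q *
          (T : ℝ) ^ (1 - H / q) * (d : ℝ) ^ (H / q + H - 1))) :=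
        ENNReal.continuous_ofReal.comp (continuous_const.mul
          (NNReal.continuous_coe.rpow_const fun _ => Or.inr hβ.le))
      simpa [Real.zero_rpow hβ.ne'] using hc.tendsto 0
    obtain ⟨δ, hδ, h⟩ := NNReal.nhds_zero_basis.eventually_iff.1 (hlim.eventually (ge_mem_nhds hε))
    exact ⟨δ, hδ, fun n t s ht hs hd =>
      (hB.eLpNorm_integral_sub_stieltjesSum_le hF hμ hT hH' hp.1 hq ht hs).trans (h hd)⟩
  · exact hB.eLpNorm_integral_sub_stieltjesSum_le hF hμ hT hH' hp.1 hq ht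
      fun i => ⟨le_rfl, (ht.castSucc_lt_succ i).le⟩
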